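/- Let $l,p,q\ge 1$ be integers, at most one of which equals $1$. The $\theta$-graph $\theta(l,p,q)$ is the graph obtained from three vertex-disjoint paths with $l$, $p$ and $q$ edges, respectively, by identifying their three first endpoints to a single vertex and their three last endpoints to a single vertex; up to isomorphism it does not depend on the order of $l,p,q$. For a finite connected graph $G$, let $D(G)=(d_G(u,v))_{u,v\in V(G)}$ denote its distance matrix, where $d_G(u,v)$ is the length of a shortest path between $u$ and $v$. Let $G$ be a graph isomorphic to $\theta(l,p,q)$. Then the following assertions hold, where the triples are considered up to the order of their entries. (a) If $\{l,p,q\}=\{1,a,b\}$ as multisets, with $a$ and $b$ even, then $\det D(G)=-\dfrac{(a+b)^2}{4}$. (b) If $\{l,p,q\}=\{2,2,2\}$ as multisets, then $\det D(G)=-16$. (c) If $\{l,p,q\}=\{2,2,r\}$ as multisets, with $r$ odd and $r>1$, then $\det D(G)=r^2-5$. (d) In all other cases, $\det D(G)=0$. -/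

import Mathlib

/-- The distance matrix `D(G)` of a finite graph: its `(u, v)` entry is the length of a shortest
path from `u` to `v` in `G`. -/
noncomputable def distanceMatrix {V : Type*} (G : SimpleGraph V) : Matrix V V ℚ :=
  Matrix.of fun u v => (G.dist u v : ℚ)

/-- Vertices of the graph obtained from three disjoint paths with `L 0`, `L 1`, `L 2` edges by
identifying the three first endpoints to one vertex (`Sum.inl false`) and the three last endpoints
to one vertex (`Sum.inl true`). The path number `i` has `L i - 1` internal vertices. -/
abbrev ThetaVertex (L : Fin 3 → ℕ) : Type :=
  Bool ⊕ (Σ i : Fin 3, Fin (L i - 1))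

/-- The vertex at distance `k` along the path number `i` from its first endpoint, for
`0 ≤ k ≤ L i` (larger values of `k` are never used). -/
def thetaPoint (L : Fin 3 → ℕ) (i : Fin 3) (k : ℕ) : ThetaVertex L :=
  if k = 0 then Sum.inl false
  else if h : k - 1 < L i - 1 then Sum.inr ⟨i, ⟨k - 1, h⟩⟩
  else Sum.inl true

/-- The graph `θ(l, p, q)`: the three paths with `l`, `p` and `q` edges, with their first
endpoints identified and their last endpoints identified. The edges are the pairs of consecutive
vertices of the three paths. -/
def thetaGraph (l p q : ℕ) : SimpleGraph (ThetaVertex ![l, p, q]) :=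
  SimpleGraph.fromRel fun x y =>
    ∃ i : Fin 3, ∃ k < ![l, p, q] i,
      x = thetaPoint ![l, p, q] i k ∧ y = thetaPoint ![l, p, q] i (k + 1)

/-! Write A and B for the first and last common endpoints of the three paths, and ℓ for the smallest
path length. A geodesic between two vertices either stays on one path or leaves through A or B,
possibly crossing between A and B along a shortest path. This gives a closed distance formula
(`dist_thetaPoint`), and the rest is linear algebra on that formula.

Vanishing: D is singular as soon as four vertices satisfy d(·,a) + d(·,b) = d(·,c) + d(·,e) with a
different from c and e. If a longer path has the parity of ℓ, it closes up with a shortest path to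
an even cycle, and A, B and their antipodes work. If two shortest paths have equal length at least
3, these pairs coincide, and antipodal pairs next to A and B are used instead. If ℓ ≥ 2 and both
other paths have the opposite parity, each of them contains a vertex farthest from A and one
farthest from B on its odd cycle, and these four vertices work. What remains is exactly (a), (b),
(c).

Case (a): θ(1, 2k, 2m) consists of two odd cycles sharing an edge. An odd cycle of length 2k + 1
embeds into the k-subsets of its 2k + 1 positions as the cyclic arcs of length k, with d(u, v) = k -
|u ∩ v|. Two such embeddings can be glued along the common edge, the arcs of the second cycle being
complemented. This gives 0-1 vectors φ of weight h = k + m in dimension n = 2k + 2m with D = hJ -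
ΦΦᵀ. Since ΦJ = hJ, the determinant reduces to (det Φ)², which is h² because the rows of Φ generate
the lattice of integer vectors with coordinate sum divisible by h. Hence det D = (-1)ⁿ h (h - n)
(`det_of_subset_embedding`).

Case (c): θ(2, 2, r) is an odd cycle with one vertex x doubled. The cycle has determinant k(k + 1)
by the same embedding, and a Schur complement (`Matrix.det_fromBlocks_twin`) needs only the solution
of Dz = e_x. Case (b) is a 5 × 5 determinant. -/

/-- The theta graph whose path lengths are the entries of `L`. -/
def thetaGraphOf (L : Fin 3 → ℕ) : SimpleGraph (ThetaVertex L) :=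
  SimpleGraph.fromRel fun x y =>
    ∃ i : Fin 3, ∃ k < L i, x = thetaPoint L i k ∧ y = thetaPoint L i (k + 1)

/-- The length of a shortest path between the `s`-th vertex of the path number `i` and the `t`-th
vertex of the path number `j`, in terms of the smallest path length `μ`. -/
def thetaDist (L : Fin 3 → ℕ) (μ : ℕ) (i : Fin 3) (s : ℕ) (j : Fin 3) (t : ℕ) : ℕ :=
  if i = j then min ((s - t) + (t - s))
    (min (min s (L i - s + μ) + t) (min (L i - s) (s + μ) + (L j - t)))
  else min (min s (L i - s + μ) + t) (min (L i - s) (s + μ) + (L j - t))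

/-! ### Distances in theta graphs -/

section Distance

variable {L : Fin 3 → ℕ}

theorem thetaPoint_zero (i : Fin 3) : thetaPoint L i 0 = Sum.inl false := by
  simp [thetaPoint]

theorem thetaPoint_last {i : Fin 3} {k : ℕ} (hk : 1 ≤ k) (h : L i ≤ k) :
    thetaPoint L i k = Sum.inl true := by
  have h1 : k ≠ 0 := by omega
  have h2 : ¬ k - 1 < L i - 1 := by omega
  simp [thetaPoint, h1, h2]

theorem thetaPoint_inner {i : Fin 3} {k : ℕ} (hk : 1 ≤ k) (h : k < L i) :
    thetaPoint L i k = Sum.inr ⟨i, ⟨k - 1, by omega⟩⟩ := by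
  have h1 : k ≠ 0 := by omega
  have h2 : k - 1 < L i - 1 := by omega
  simp [thetaPoint, h1, h2]

theorem exists_thetaPoint_eq (hL : ∀ i, 1 ≤ L i) (v : ThetaVertex L) :
    ∃ i, ∃ k ≤ L i, v = thetaPoint L i k := by
  rcases v with (_ | _) | ⟨i, k, hk⟩
  · exact ⟨0, 0, Nat.zero_le _, (thetaPoint_zero 0).symm⟩
  · exact ⟨0, L 0, le_rfl, (thetaPoint_last (hL 0) le_rfl).symm⟩
  · refine ⟨i, k + 1, by omega, ?_⟩
    rw [thetaPoint_inner (by omega) (by omega)]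
    simp

theorem thetaPoint_ne_succ {i : Fin 3} {k : ℕ} (h : k < L i) :
    thetaPoint L i k ≠ thetaPoint L i (k + 1) := by
  rcases Nat.eq_zero_or_pos k with rfl | hk
  · rw [thetaPoint_zero]
    by_cases h1 : 1 < L i
    · rw [thetaPoint_inner (by omega) (by omega)]; simp
    · rw [thetaPoint_last (by omega) (by omega)]; simp
  · rw [thetaPoint_inner hk h]
    by_cases h1 : k + 1 < L i
    · rw [thetaPoint_inner (by omega) (by omega)]
      simp only [ne_eq, Sum.inr.injEq, Sigma.mk.injEq, heq_eq_eq, true_and, Fin.mk.injEq]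
      omega
    · rw [thetaPoint_last (by omega) (by omega)]; simp

theorem thetaGraphOf_adj_succ {i : Fin 3} {k : ℕ} (h : k < L i) :
    (thetaGraphOf L).Adj (thetaPoint L i k) (thetaPoint L i (k + 1)) :=
  (SimpleGraph.fromRel_adj _ _ _).2 ⟨thetaPoint_ne_succ h, Or.inl ⟨i, k, h, rfl, rfl⟩⟩

theorem exists_walk_along (i : Fin 3) (s m : ℕ) (h : s + m ≤ L i) :
    ∃ w : (thetaGraphOf L).Walk (thetaPoint L i s) (thetaPoint L i (s + m)), w.length = m := by
  induction m with
  | zero => exact ⟨SimpleGraph.Walk.nil, rfl⟩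
  | succ m ih =>
    obtain ⟨w, hw⟩ := ih (by omega)
    exact ⟨w.concat (thetaGraphOf_adj_succ (by omega)), by simp [hw]⟩

theorem exists_walk_between (i : Fin 3) {s t : ℕ} (hs : s ≤ L i) (ht : t ≤ L i) :
    ∃ w : (thetaGraphOf L).Walk (thetaPoint L i s) (thetaPoint L i t),
      w.length = (s - t) + (t - s) := by
  rcases le_total s t with h | h
  · obtain ⟨m, rfl⟩ := Nat.exists_eq_add_of_le h
    obtain ⟨w, hw⟩ := exists_walk_along i s m ht
    exact ⟨w, by omega⟩
  · obtain ⟨m, rfl⟩ := Nat.exists_eq_add_of_le h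
    obtain ⟨w, hw⟩ := exists_walk_along i t m hs
    exact ⟨w.reverse, by rw [SimpleGraph.Walk.length_reverse]; omega⟩

theorem exists_walk_first (i : Fin 3) {s : ℕ} (hs : s ≤ L i) :
    ∃ w : (thetaGraphOf L).Walk (thetaPoint L i s) (Sum.inl false), w.length = s := by
  have := exists_walk_between i hs (Nat.zero_le (L i))
  rw [thetaPoint_zero] at this
  simpa using this

theorem exists_walk_last (hL : ∀ i, 1 ≤ L i) (i : Fin 3) {s : ℕ} (hs : s ≤ L i) :
    ∃ w : (thetaGraphOf L).Walk (thetaPoint L i s) (Sum.inl true), w.length = L i - s := by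
  obtain ⟨w, hw⟩ := exists_walk_between i hs (le_refl (L i))
  rw [← thetaPoint_last (hL i) le_rfl]
  exact ⟨w, by omega⟩

theorem exists_walk_thetaDist (hL : ∀ i, 1 ≤ L i) {c i j : Fin 3} {s t : ℕ}
    (hs : s ≤ L i) (ht : t ≤ L j) :
    ∃ w : (thetaGraphOf L).Walk (thetaPoint L i s) (thetaPoint L j t),
      w.length = thetaDist L (L c) i s j t := by
  obtain ⟨w0, h0⟩ := exists_walk_first i hs
  obtain ⟨w1, h1⟩ := exists_walk_last hL i hs
  obtain ⟨w2, h2⟩ := exists_walk_first j ht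
  obtain ⟨w3, h3⟩ := exists_walk_last hL j ht
  obtain ⟨w4, h4⟩ : ∃ w : (thetaGraphOf L).Walk (Sum.inl true) (Sum.inl false),
      w.length = L c := by
    have := exists_walk_first (L := L) c le_rfl
    rwa [thetaPoint_last (hL c) le_rfl] at this
  have key : ∃ w : (thetaGraphOf L).Walk (thetaPoint L i s) (thetaPoint L j t),
      w.length = min (min s (L i - s + L c) + t) (min (L i - s) (s + L c) + (L j - t)) := by
    rcases le_total (min s (L i - s + L c) + t) (min (L i - s) (s + L c) + (L j - t)) with h | h
    · rw [min_eq_left h]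
      rcases le_total s (L i - s + L c) with h' | h'
      · rw [min_eq_left h']
        exact ⟨w0.append w2.reverse, by simp [h0, h2]⟩
      · rw [min_eq_right h']
        exact ⟨(w1.append w4).append w2.reverse, by simp [h1, h2, h4]⟩
    · rw [min_eq_right h]
      rcases le_total (L i - s) (s + L c) with h' | h'
      · rw [min_eq_left h']
        exact ⟨w1.append w3.reverse, by simp [h1, h3]⟩
      · rw [min_eq_right h']
        exact ⟨(w0.append w4.reverse).append w3.reverse, by simp [h0, h3, h4]⟩
  unfold thetaDist
  split_ifs with hij
  · subst hij
    rcases le_total ((s - t) + (t - s))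
      (min (min s (L i - s + L c) + t) (min (L i - s) (s + L c) + (L i - t))) with h | h
    · rw [min_eq_left h]
      exact exists_walk_between i hs ht
    · rw [min_eq_right h]
      exact key
  · exact key

/-- `thetaDist` from a fixed source, as a function of the vertex. -/
def thetaDistFrom (L : Fin 3 → ℕ) (μ : ℕ) (i : Fin 3) (s : ℕ) : ThetaVertex L → ℕ
  | Sum.inl false => min s (L i - s + μ)
  | Sum.inl true => min (L i - s) (s + μ)
  | Sum.inr ⟨j, t⟩ => thetaDist L μ i s j (t + 1)

theorem thetaDistFrom_thetaPoint (hL : ∀ i, 1 ≤ L i) {μ : ℕ} (hμ : ∀ i, μ ≤ L i) {i j : Fin 3}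
    {s t : ℕ} (hs : s ≤ L i) (ht : t ≤ L j) :
    thetaDistFrom L μ i s (thetaPoint L j t) = thetaDist L μ i s j t := by
  have h1 := hL j
  have h2 := hμ j
  rcases Nat.eq_zero_or_pos t with rfl | ht0
  · rw [thetaPoint_zero]
    simp only [thetaDistFrom, thetaDist]
    split_ifs with h
    · subst h; omega
    · omega
  · rcases Nat.lt_or_ge t (L j) with h | h
    · rw [thetaPoint_inner ht0 h]
      simp only [thetaDistFrom]
      rw [Nat.sub_add_cancel ht0]
    · rw [thetaPoint_last ht0 h]
      obtain rfl : t = L j := le_antisymm ht h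
      simp only [thetaDistFrom, thetaDist]
      split_ifs with h
      · subst h; omega
      · omega

theorem thetaDistFrom_adj_le (hL : ∀ i, 1 ≤ L i) {μ : ℕ} (hμ : ∀ i, μ ≤ L i) {i : Fin 3}
    {s : ℕ} (hs : s ≤ L i) {x y : ThetaVertex L} (h : (thetaGraphOf L).Adj x y) :
    thetaDistFrom L μ i s x ≤ thetaDistFrom L μ i s y + 1 := by
  obtain ⟨-, ⟨j, t, ht, rfl, rfl⟩ | ⟨j, t, ht, rfl, rfl⟩⟩ := (SimpleGraph.fromRel_adj _ _ _).1 h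
  all_goals
    rw [thetaDistFrom_thetaPoint hL hμ hs ht.le, thetaDistFrom_thetaPoint hL hμ hs ht]
    simp only [thetaDist]
    split_ifs <;> omega

theorem dist_thetaPoint (hL : ∀ i, 1 ≤ L i) {c : Fin 3} (hc : ∀ i, L c ≤ L i) {i j : Fin 3}
    {s t : ℕ} (hs : s ≤ L i) (ht : t ≤ L j) :
    (thetaGraphOf L).dist (thetaPoint L i s) (thetaPoint L j t) = thetaDist L (L c) i s j t := by
  obtain ⟨w, hw⟩ := exists_walk_thetaDist hL (c := c) hs ht
  refine le_antisymm (hw ▸ SimpleGraph.dist_le w) ?_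
  obtain ⟨w', hw'⟩ := w.reachable.exists_walk_length_eq_dist
  rw [← hw', ← thetaDistFrom_thetaPoint hL hc hs ht]
  -- Lower bound: the candidate distance from the source grows by at most 1 along each edge and
  -- vanishes at the source.
  have key : ∀ {x y : ThetaVertex L} (p : (thetaGraphOf L).Walk x y),
      thetaDistFrom L (L c) i s y ≤ thetaDistFrom L (L c) i s x + p.length := by
    intro x y p
    induction p with
    | nil => simp
    | cons h p ih =>
      have := thetaDistFrom_adj_le hL hc hs h.symm
      rw [SimpleGraph.Walk.length_cons]
      omega
  have h0 : thetaDistFrom L (L c) i s (thetaPoint L i s) = 0 := by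
    rw [thetaDistFrom_thetaPoint hL hc hs hs, thetaDist, if_pos rfl]
    omega
  have := key w'
  omega

end Distance

/-! ### Singular distance matrices from relations between four columns -/

/-- A matrix is singular if the sum of two of its columns is the sum of two other ones. -/
theorem Matrix.det_eq_zero_of_add_eq_add {V : Type*} [Fintype V] [DecidableEq V]
    (M : Matrix V V ℚ) {a b c e : V} (hac : a ≠ c) (hae : a ≠ e)
    (h : ∀ u, M u a + M u b = M u c + M u e) : M.det = 0 := by
  -- The kernel vector has entry 2 or 1 at `a`, so no other distinctness is needed.
  by_cases hab : a = b
  · subst hab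
    refine Matrix.exists_mulVec_eq_zero_iff.1
      ⟨Pi.single a 1 + Pi.single a 1 - Pi.single c 1 - Pi.single e 1, ?_, ?_⟩
    · intro h0
      have := congrFun h0 a
      simp [hac, hae] at this
    · ext u
      simp only [Matrix.mulVec_sub, Matrix.mulVec_add, Matrix.mulVec_single_one, Pi.sub_apply,
        Pi.add_apply, Matrix.col_apply, Pi.zero_apply]
      linarith [h u]
  · refine Matrix.exists_mulVec_eq_zero_iff.1
      ⟨Pi.single a 1 + Pi.single b 1 - Pi.single c 1 - Pi.single e 1, ?_, ?_⟩
    · intro h0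
      have := congrFun h0 a
      simp [hac, hae, hab] at this
    · ext u
      simp only [Matrix.mulVec_sub, Matrix.mulVec_add, Matrix.mulVec_single_one, Pi.sub_apply,
        Pi.add_apply, Matrix.col_apply, Pi.zero_apply]
      linarith [h u]

section Singular

variable {L : Fin 3 → ℕ}

theorem thetaPoint_ne (hL : ∀ i, 1 ≤ L i) {c : Fin 3} (hc : ∀ i, L c ≤ L i) {i j : Fin 3}
    {s t : ℕ} (hs : s ≤ L i) (ht : t ≤ L j) (h : thetaDist L (L c) i s j t ≠ 0) :
    thetaPoint L i s ≠ thetaPoint L j t := by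
  intro h'
  rw [← dist_thetaPoint hL hc hs ht, h', SimpleGraph.dist_self] at h
  exact h rfl

/-- Four vertices of a theta graph whose distance columns are linearly dependent. -/
theorem det_distanceMatrix_thetaGraphOf_eq_zero (hL : ∀ i, 1 ≤ L i) {c : Fin 3}
    (hc : ∀ i, L c ≤ L i) {i₁ i₂ i₃ i₄ : Fin 3} {s₁ s₂ s₃ s₄ : ℕ} (h₁ : s₁ ≤ L i₁)
    (h₂ : s₂ ≤ L i₂) (h₃ : s₃ ≤ L i₃) (h₄ : s₄ ≤ L i₄)
    (h₁₃ : thetaDist L (L c) i₁ s₁ i₃ s₃ ≠ 0) (h₁₄ : thetaDist L (L c) i₁ s₁ i₄ s₄ ≠ 0)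
    (h : ∀ i, ∀ s ≤ L i, thetaDist L (L c) i s i₁ s₁ + thetaDist L (L c) i s i₂ s₂ =
      thetaDist L (L c) i s i₃ s₃ + thetaDist L (L c) i s i₄ s₄) :
    (distanceMatrix (thetaGraphOf L)).det = 0 := by
  refine Matrix.det_eq_zero_of_add_eq_add _ (thetaPoint_ne hL hc h₁ h₃ h₁₃)
    (thetaPoint_ne hL hc h₁ h₄ h₁₄) (b := thetaPoint L i₂ s₂) fun u => ?_
  obtain ⟨i, s, hs, rfl⟩ := exists_thetaPoint_eq hL u
  simp only [distanceMatrix, Matrix.of_apply]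
  rw [dist_thetaPoint hL hc hs h₁, dist_thetaPoint hL hc hs h₂, dist_thetaPoint hL hc hs h₃,
    dist_thetaPoint hL hc hs h₄]
  exact_mod_cast h i s hs

/-- The paths `c` and `j` form a cycle of length 2m. The chosen vertices are A with its antipode and
B with its antipode. On the cycle both sums equal m. A vertex of the third path at distances x, y
from A, B is at distance y + m - ℓ from the antipode of A and x + m - ℓ from that of B, where ℓ = `L
c`, so both sums agree again. -/
theorem det_eq_zero_of_lt_of_even_add (hL : ∀ i, 1 ≤ L i) {c j : Fin 3} (hc : ∀ i, L c ≤ L i)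
    (hlt : L c < L j) (hpar : Even (L c + L j)) :
    (distanceMatrix (thetaGraphOf L)).det = 0 := by
  obtain ⟨m, hm⟩ := hpar
  have hcj : c ≠ j := by rintro rfl; exact lt_irrefl _ hlt
  have h1 := hL c
  refine det_distanceMatrix_thetaGraphOf_eq_zero hL hc (i₁ := c) (i₂ := j) (i₃ := c) (i₄ := j)
    (s₁ := 0) (s₂ := m) (s₃ := L c) (s₄ := m - L c) (by omega) (by omega) (by omega) (by omega)
    ?_ ?_ ?_
  · simp only [thetaDist, if_pos]
    omega
  · simp only [thetaDist, if_neg hcj]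
    omega
  · intro i s hs
    have h2 := hc i
    obtain ⟨a, ha⟩ := Nat.exists_eq_add_of_le hs
    have has : L i - s = a := by omega
    simp only [thetaDist, has]
    rcases le_total s (a + L c) with h4 | h4 <;> rcases le_total a (s + L c) with h5 | h5 <;>
    simp only [h4, h5, min_eq_left, min_eq_right]
    all_goals
      by_cases hic : i = c
      · subst hic
        simp only [if_pos, if_neg hcj]
        simp (disch := omega) only [min_eq_left, min_eq_right]
        omega
      · by_cases hij : i = j
        · subst hij
          simp only [if_pos, if_neg hic]
          rcases le_total s m with h6 | h6 <;> rcases le_total s (m - L c) with h7 | h7 <;>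
          simp (disch := omega) only [min_eq_left, min_eq_right] <;>
          omega
        · simp only [if_neg hic, if_neg hij]
          simp (disch := omega) only [min_eq_left, min_eq_right]
          omega

/-- Two antipodal pairs on the cycle formed by `c` and `j`. Off this cycle the relation holds
because exchanging two paths of equal length is a symmetry. For length 2 the vertices at places 1
and `L c - 1` would coincide. -/
theorem det_eq_zero_of_eq (hL : ∀ i, 1 ≤ L i) {c j : Fin 3} (hc : ∀ i, L c ≤ L i)
    (hcj : c ≠ j) (heq : L c = L j) (h3 : 3 ≤ L c) :
    (distanceMatrix (thetaGraphOf L)).det = 0 := by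
  refine det_distanceMatrix_thetaGraphOf_eq_zero hL hc (i₁ := c) (i₂ := j) (i₃ := c) (i₄ := j)
    (s₁ := 1) (s₂ := L c - 1) (s₃ := L c - 1) (s₄ := 1) (by omega) (by omega) (by omega)
    (by omega) ?_ ?_ ?_
  · simp only [thetaDist, if_pos]
    omega
  · simp only [thetaDist, if_neg hcj]
    omega
  · intro i s hs
    have h2 := hc i
    obtain ⟨a, ha⟩ := Nat.exists_eq_add_of_le hs
    have has : L i - s = a := by omega
    simp only [thetaDist, has]
    rcases le_total s (a + L c) with h4 | h4 <;> rcases le_total a (s + L c) with h5 | h5 <;>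
    simp only [h4, h5, min_eq_left, min_eq_right]
    all_goals
      by_cases hic : i = c
      · subst hic
        simp only [if_pos, if_neg hcj]
        rcases le_total s 1 with h6 | h6 <;> rcases le_total s (L i - 1) with h7 | h7 <;>
        simp (disch := omega) only [min_eq_left, min_eq_right] <;>
        omega
      · by_cases hij : i = j
        · subst hij
          simp only [if_pos, if_neg hic]
          rcases le_total s 1 with h6 | h6 <;> rcases le_total s (L c - 1) with h7 | h7 <;>
          simp (disch := omega) only [min_eq_left, min_eq_right] <;>
          omega
        · simp only [if_neg hic, if_neg hij]
          omega

set_option maxHeartbeats 600000 in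
-- With ℓ = `L c`, the place m on `j` is at distance m from A, the maximum on the cycle of length 2m
-- + 1, and the place m + 1 - ℓ is likewise farthest from B; similarly for n on `k`. On either path,
-- the distance to the second place minus the distance to the first is d(·,A) - d(·,B) truncated to
-- [1 - ℓ, ℓ - 1], which does not depend on the path. For ℓ = 1 the two places coincide.
theorem det_eq_zero_of_odd_add (hL : ∀ i, 1 ≤ L i) {c j k : Fin 3} (hc : ∀ i, L c ≤ L i)
    (hjk : j ≠ k) (hcj : Odd (L c + L j)) (hck : Odd (L c + L k)) (h2 : 2 ≤ L c) :
    (distanceMatrix (thetaGraphOf L)).det = 0 := by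
  obtain ⟨m, hm⟩ := hcj
  obtain ⟨n, hn⟩ := hck
  have hj := hc j
  have hk := hc k
  refine det_distanceMatrix_thetaGraphOf_eq_zero hL hc (i₁ := j) (i₂ := k) (i₃ := j) (i₄ := k)
    (s₁ := m + 1 - L c) (s₂ := n) (s₃ := m) (s₄ := n + 1 - L c) (by omega) (by omega) (by omega)
    (by omega) ?_ ?_ ?_
  · simp only [thetaDist, if_pos]
    omega
  · simp only [thetaDist, if_neg hjk]
    omega
  · intro i s hs
    have h2 := hc i
    obtain ⟨a, ha⟩ := Nat.exists_eq_add_of_le hs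
    have has : L i - s = a := by omega
    simp only [thetaDist, has]
    rcases le_total s (a + L c) with h4 | h4 <;> rcases le_total a (s + L c) with h5 | h5 <;>
    simp only [h4, h5, min_eq_left, min_eq_right]
    all_goals
      by_cases hic : i = j
      · subst hic
        simp only [if_pos, if_neg hjk]
        rcases le_total s m with h6 | h6 <;> rcases le_total s (m + 1 - L c) with h7 | h7 <;>
        simp (disch := omega) only [min_eq_left, min_eq_right] <;>
        omega
      · by_cases hij : i = k
        · subst hij
          simp only [if_pos, if_neg hic]
          rcases le_total s n with h6 | h6 <;> rcases le_total s (n + 1 - L c) with h7 | h7 <;>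
          simp (disch := omega) only [min_eq_left, min_eq_right] <;>
          omega
        · simp only [if_neg hic, if_neg hij]
          try simp (disch := omega) only [min_eq_left, min_eq_right]
          omega

end Singular

/-! ### Determinants of matrices of the form hJ - ΦΦᵀ -/

/-- If the rows of an integer matrix have sum `h ≠ 0` and all differences of coordinate vectors are
integer combinations of its rows, then its determinant is `h` up to sign. -/
theorem Matrix.det_sq_of_row_sum {ι : Type*} [Fintype ι] [DecidableEq ι] (Φ : Matrix ι ι ℤ)
    {h : ℤ} (hh : h ≠ 0) (hrow : ∀ i, ∑ j, Φ i j = h) (c₀ : ι)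
    (hspan : ∀ c, ∃ w : ι → ℤ, Matrix.vecMul w Φ = Pi.single c 1 - Pi.single c₀ 1) :
    Φ.det ^ 2 = h ^ 2 := by
  choose w hw using hspan
  set v : ι → ℤ := fun c => if c = c₀ then h else -1 with hv
  -- The rows of `T`, namely e_c - e_{c₀} and h e_{c₀}, form a basis of the lattice of vectors with
  -- sum divisible by h. `Φ` and `T` are integer multiples of each other, so their determinants
  -- agree up to sign.
  set T : Matrix ι ι ℤ := (1 : Matrix ι ι ℤ).updateCol c₀ v with hT
  have hTdet : T.det = h := by
    have h1 : T.det = Matrix.cramer 1 v c₀ := (Matrix.cramer_apply _ _ _).symm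
    rw [h1, Matrix.cramer_one]
    simp [hv]
  have hΦ : Φ = Φ.updateCol c₀ (fun _ => 1) * T := by
    ext i e
    rw [Matrix.mul_apply]
    by_cases he : e = c₀
    · subst he
      have h1 : ∀ c, Φ.updateCol e (fun _ => 1) i c * T c e =
          (if c = e then h + Φ i e else 0) - Φ i c := by
        intro c
        by_cases hc : c = e
        · subst hc; simp [hT, hv]
        · simp [hT, hv, hc]
      simp_rw [h1]
      rw [Finset.sum_sub_distrib, hrow]
      simp
    · have h1 : ∀ c, T c e = if c = e then 1 else 0 := by
        intro c
        rw [hT, Matrix.updateCol_ne he, Matrix.one_apply]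
      simp_rw [h1]
      simp [Matrix.updateCol_ne he]
  -- Row c₀ of `Φ` is h e_{c₀} plus a combination of the e_c - e_{c₀}; solving for h e_{c₀} gives
  -- row c₀ of the left factor.
  have hW : T = (Matrix.of fun c => if c = c₀ then Pi.single c₀ 1 - ∑ c', Φ c₀ c' • w c'
      else w c) * Φ := by
    ext c e
    have h1 : ((Matrix.of fun c => if c = c₀ then Pi.single c₀ 1 - ∑ c', Φ c₀ c' • w c'
        else w c) * Φ) c e = Matrix.vecMul
          (if c = c₀ then Pi.single c₀ 1 - ∑ c', Φ c₀ c' • w c' else w c) Φ e := by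
      rw [Matrix.mul_apply]; rfl
    rw [h1]
    by_cases hc : c = c₀
    · subst hc
      rw [if_pos rfl, Matrix.sub_vecMul, Matrix.sum_vecMul]
      simp only [Matrix.smul_vecMul, hw, Pi.sub_apply, Matrix.single_one_vecMul, Finset.sum_apply,
        Pi.smul_apply, smul_eq_mul, mul_sub, Finset.sum_sub_distrib, ← Finset.sum_mul, hrow]
      by_cases he : e = c
      · subst he; simp [hT, hv, Pi.single_apply]
      · simp [hT, he, Pi.single_apply, Ne.symm he]
    · rw [if_neg hc, hw]
      by_cases he : e = c₀
      · subst he; simp [hT, hv, hc, Ne.symm hc]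
      · simp [hT, he, Pi.single_apply, Matrix.one_apply, eq_comm]
  have e1 := congrArg Matrix.det hΦ
  have e2 := congrArg Matrix.det hW
  rw [Matrix.det_mul, hTdet] at e1 e2
  have e3 : (Φ.updateCol c₀ fun _ => 1).det * (Matrix.of fun c => if c = c₀ then
      Pi.single c₀ 1 - ∑ c', Φ c₀ c' • w c' else w c).det = 1 := by
    apply mul_right_cancel₀ hh
    rw [one_mul]
    conv_rhs => rw [e2, e1]
    ring
  have e4 : (Φ.updateCol c₀ fun _ => 1).det ^ 2 = 1 := by
    rcases Int.isUnit_iff.1 (IsUnit.of_mul_eq_one _ e3) with h1 | h1 <;> simp [h1]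
  rw [e1, mul_pow, e4, one_mul]

/-- Constant row sums give ΦJ = hJ, so hJ - ΦΦᵀ = -Φ(1 - J/h)Φᵀ, and the middle factor is a rank-one
perturbation of the identity. -/
theorem Matrix.det_sub_mul_transpose {ι : Type*} [Fintype ι] [DecidableEq ι] (Φ : Matrix ι ι ℚ)
    {h : ℚ} (hh : h ≠ 0) (hrow : ∀ i, ∑ j, Φ i j = h) :
    (Matrix.of fun i j => h - ∑ c, Φ i c * Φ j c).det =
      (-1) ^ Fintype.card ι * (1 - Fintype.card ι / h) * Φ.det ^ 2 := by
  set C : Matrix ι Unit ℚ := Matrix.replicateCol Unit fun _ => -h⁻¹ with hC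
  set R : Matrix Unit ι ℚ := Matrix.replicateRow Unit fun _ => 1 with hR
  have hΦC : Φ * C = Matrix.replicateCol Unit fun _ => -1 := by
    ext i j
    simp [hC, Matrix.mul_apply, ← Finset.sum_mul, hrow, hh]
  have hRΦ : R * Φ.transpose = Matrix.replicateRow Unit fun _ => h := by
    ext i j
    simp [hR, Matrix.mul_apply, hrow]
  have h1 : (Matrix.of fun i j => h - ∑ c, Φ i c * Φ j c) =
      Φ * -(1 + C * R) * Φ.transpose := by
    have h2 : Φ * -(1 + C * R) * Φ.transpose =
        -(Φ * Φ.transpose) - (Φ * C) * (R * Φ.transpose) := by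
      simp only [Matrix.mul_neg, Matrix.neg_mul, Matrix.mul_add, Matrix.add_mul, Matrix.mul_one,
        Matrix.mul_assoc]
      abel
    rw [h2, hΦC, hRΦ]
    ext i j
    simp [Matrix.mul_apply]
    ring
  rw [h1, Matrix.det_mul, Matrix.det_mul, Matrix.det_transpose, Matrix.det_neg,
    Matrix.det_one_add_replicateCol_mul_replicateRow]
  simp [dotProduct]
  ring

/-- Let `d` be a function on pairs of indices `< n` that measures the distance of `0`-`1`-vectors
`φ 0, …, φ (n - 1)` of length `n` and weight `h`, each of which arises from the previous one by
moving a `1` from place `α i` to place `β i`. If the differences of coordinate vectors are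
integer combinations of these vectors, then the determinant of `d` is `(-1) ^ n * h * (h - n)`. -/
theorem det_of_subset_embedding {n : ℕ} (hn : 0 < n) {h : ℤ} (hh : h ≠ 0) (d φ : ℕ → ℕ → ℤ)
    (α β : ℕ → ℕ)
    (hstep : ∀ i, i + 1 < n → α i < n ∧ β i < n ∧ ∀ c < n,
      φ (i + 1) c = φ i c + (if c = β i then 1 else 0) - (if c = α i then 1 else 0))
    (h₀ : ∑ c ∈ Finset.range n, φ 0 c = h) (h₀₀ : ∀ c < n, φ 0 c * φ 0 c = φ 0 c)
    (d₀₀ : d 0 0 = 0) (dsymm : ∀ i < n, d 0 i = d i 0)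
    (hd : ∀ i < n, ∀ j, j + 1 < n → d i j - d i (j + 1) = φ i (β j) - φ i (α j))
    (c₀ : ℕ) (hc₀ : c₀ < n)
    (hspan : ∀ c < n, ∃ u < n, ∃ v < n, ∃ u' < n, ∃ v' < n, ∀ e < n,
      φ u e + φ v e - φ u' e - φ v' e = (if e = c then 1 else 0) - (if e = c₀ then 1 else 0)) :
    (Matrix.of fun i j : Fin n => (d i j : ℚ)).det = (-1) ^ n * (h * (h - n)) := by
  have hsum : ∀ i < n, ∑ c ∈ Finset.range n, φ i c = h := by
    intro i
    induction i with
    | zero => intro _; exact h₀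
    | succ i ih =>
      intro hi
      obtain ⟨h1, h2, h3⟩ := hstep i hi
      rw [Finset.sum_congr rfl fun c hc => h3 c (Finset.mem_range.1 hc)]
      rw [Finset.sum_sub_distrib, Finset.sum_add_distrib, ih (by omega)]
      simp [h1, h2]
  have hstep' : ∀ i < n, ∀ j, j + 1 < n → ∑ c ∈ Finset.range n, φ i c * φ (j + 1) c =
      ∑ c ∈ Finset.range n, φ i c * φ j c + φ i (β j) - φ i (α j) := by
    intro i _ j hj
    obtain ⟨h1, h2, h3⟩ := hstep j hj
    rw [Finset.sum_congr rfl fun c hc =>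
      congrArg (φ i c * ·) (h3 c (Finset.mem_range.1 hc))]
    simp [mul_add, mul_sub, Finset.sum_add_distrib, h1, h2]
  -- The step relation propagates the identity only along a row, starting from column 0. Row 0 comes
  -- first; symmetry then supplies column 0 of all other rows.
  have hind : ∀ i < n, d i 0 = h - ∑ c ∈ Finset.range n, φ i c * φ 0 c →
      ∀ j < n, d i j = h - ∑ c ∈ Finset.range n, φ i c * φ j c := by
    intro i hi h1 j
    induction j with
    | zero => intro _; exact h1
    | succ j ih =>
      intro hj
      rw [hstep' i hi j hj]
      linarith [hd i hi j hj, ih (by omega)]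
  have h00 := hind 0 hn (by
    rw [d₀₀, Finset.sum_congr rfl fun c hc => h₀₀ c (Finset.mem_range.1 hc), h₀, sub_self])
  have hall : ∀ i < n, ∀ j < n, d i j = h - ∑ c ∈ Finset.range n, φ i c * φ j c := by
    intro i hi
    refine hind i hi ?_
    rw [← dsymm i hi, h00 i hi]
    simp only [mul_comm]
  set Φ : Matrix (Fin n) (Fin n) ℤ := Matrix.of fun i c => φ i c with hΦ
  have hrow : ∀ i, ∑ c, Φ i c = h := fun i => by
    rw [← hsum i i.2, Finset.sum_range]; rfl
  have hsq := Matrix.det_sq_of_row_sum Φ hh hrow ⟨c₀, hc₀⟩ (by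
    rintro ⟨c, hc⟩
    obtain ⟨u, hu, v, hv, u', hu', v', hv', he⟩ := hspan c hc
    refine ⟨Pi.single ⟨u, hu⟩ 1 + Pi.single ⟨v, hv⟩ 1 - Pi.single ⟨u', hu'⟩ 1 -
      Pi.single ⟨v', hv'⟩ 1, ?_⟩
    ext e
    simpa [Matrix.sub_vecMul, Matrix.add_vecMul, Pi.single_apply, hΦ, Fin.ext_iff] using he e e.2)
  have hh' : (h : ℚ) ≠ 0 := by exact_mod_cast hh
  have hmat : (Matrix.of fun i j : Fin n => (d i j : ℚ)) = Matrix.of fun i j =>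
      (h : ℚ) - ∑ c, (Φ.map (Int.cast : ℤ → ℚ)) i c * (Φ.map (Int.cast : ℤ → ℚ)) j c := by
    ext i j
    simp only [Matrix.of_apply, Matrix.map_apply, hΦ]
    rw [hall i i.2 j j.2, Finset.sum_range]
    push_cast
    rfl
  have hdet : (Φ.map (Int.cast : ℤ → ℚ)).det = (Φ.det : ℚ) :=
    (Int.cast_det Φ).symm
  rw [hmat, Matrix.det_sub_mul_transpose _ hh', hdet, Fintype.card_fin]
  · have : (Φ.det : ℚ) ^ 2 = (h : ℚ) ^ 2 := by exact_mod_cast hsq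
    rw [this]
    field_simp
  · intro i
    have := hrow i
    simp only [Matrix.map_apply]
    exact_mod_cast this

/-! ### The subset embedding of θ(1, 2k, 2m) -/

/-- Distances in `θ(1, 2 * k, 2 * m)`, the vertices being numbered along a Hamiltonian cycle:
first the path with `2 * k` edges, then the one with `2 * m` edges, backwards. -/
def evenThetaDist (k m i j : ℕ) : ℕ :=
  if i ≤ 2 * k then
    if j ≤ 2 * k then min ((i - j) + (j - i)) (2 * k + 1 - ((i - j) + (j - i)))
    else min (min i (2 * k + 1 - i) + (2 * k + 2 * m - j)) (min (2 * k - i) (i + 1) + (j - 2 * k))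
  else
    if j ≤ 2 * k then
      min (min j (2 * k + 1 - j) + (2 * k + 2 * m - i)) (min (2 * k - j) (j + 1) + (i - 2 * k))
    else min ((i - j) + (j - i)) (2 * m + 1 - ((i - j) + (j - i)))

/-- The position of a coordinate in the cyclic order used for the path with `2 * m` edges. -/
def evenThetaPos (k m c : ℕ) : ℕ :=
  if c + 1 = k then m - 1 else if c = 2 * k then 2 * m else if c < 2 * k + m then c - 2 * k - 1
  else c - 2 * k

/-- The `c`-th coordinate of the vertex number `i` of `θ(1, 2 * k, 2 * m)`. -/
def evenThetaVec (k m i c : ℕ) : ℤ :=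
  if i ≤ 2 * k then
    if c ≤ 2 * k then if i ≤ c ∧ c < i + k ∨ c + k + 1 < i then 1 else 0
    else if 2 * k + m ≤ c then 1 else 0
  else
    if c + 1 < k then 1 else if k ≤ c ∧ c < 2 * k then 0
    else if i ≤ 2 * k + evenThetaPos k m c ∧ 2 * k + evenThetaPos k m c < i + m ∨
      2 * k + evenThetaPos k m c + m + 1 < i then 0 else 1

/-- The coordinate at a given position in the cyclic order used for the path with `2 * m` edges. -/
def evenThetaCoord (k m s : ℕ) : ℕ :=
  if s + 1 < m then 2 * k + 1 + s else if s + 1 = m then k - 1 else if s < 2 * m then 2 * k + s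
  else 2 * k

/-- The coordinate that is lost on the way from the vertex number `i` to the next one. -/
def evenThetaOut (k m i : ℕ) : ℕ :=
  if i < 2 * k then i
  else if i ≤ 2 * k + m then evenThetaCoord k m (i - 2 * k + m)
  else evenThetaCoord k m (i - 2 * k - m - 1)

/-- The coordinate that is gained on the way from the vertex number `i` to the next one. -/
def evenThetaIn (k m i : ℕ) : ℕ :=
  if i ≤ k ∧ i < 2 * k then i + k else if i < 2 * k then i - k - 1
  else evenThetaCoord k m (i - 2 * k)

theorem eq_evenThetaCoord_iff {k m c s : ℕ} (hk : 1 ≤ k) (hm : 1 ≤ m) (hc : c < 2 * k + 2 * m)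
    (hs : s ≤ 2 * m) : c = evenThetaCoord k m s ↔
      ¬ c + 1 < k ∧ ¬ (k ≤ c ∧ c < 2 * k) ∧ evenThetaPos k m c = s := by
  unfold evenThetaCoord evenThetaPos
  split_ifs <;> omega

theorem evenThetaCoord_lt {k m s : ℕ} (hk : 1 ≤ k) (hm : 1 ≤ m) :
    evenThetaCoord k m s < 2 * k + 2 * m := by
  unfold evenThetaCoord
  split_ifs <;> omega

theorem evenThetaPos_le {k m c : ℕ} (hm : 1 ≤ m) (hc : c < 2 * k + 2 * m) :
    evenThetaPos k m c ≤ 2 * m := by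
  unfold evenThetaPos
  split_ifs <;> omega

theorem evenThetaVec_of_le {k m i c : ℕ} (hi : i ≤ 2 * k) : evenThetaVec k m i c =
    if c ≤ 2 * k then if i ≤ c ∧ c < i + k ∨ c + k + 1 < i then 1 else 0
    else if 2 * k + m ≤ c then 1 else 0 := by
  rw [evenThetaVec, if_pos hi]

/-- This covers t = 0, the endpoint B lying on both cycles. The descriptions agree there because
coordinates k - 1 and 2k, exchanged along the common edge AB, sit at positions m - 1 and 2m of the
second cyclic order. -/
theorem evenThetaVec_add {k m t c : ℕ} (hk : 1 ≤ k) (hm : 1 ≤ m) (hc : c < 2 * k + 2 * m) :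
    evenThetaVec k m (2 * k + t) c =
    if c + 1 < k then 1 else if k ≤ c ∧ c < 2 * k then 0
    else if t ≤ evenThetaPos k m c ∧ evenThetaPos k m c < t + m ∨
      evenThetaPos k m c + m + 1 < t then 0 else 1 := by
  rcases Nat.eq_zero_or_pos t with rfl | ht
  · rw [add_zero, evenThetaVec_of_le le_rfl]
    unfold evenThetaPos
    split_ifs <;> omega
  · have h1 : ¬ 2 * k + t ≤ 2 * k := by omega
    rw [evenThetaVec, if_neg h1]
    generalize evenThetaPos k m c = p
    congr 3
    simp only [eq_iff_iff]
    omega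

/-- Each step rotates an arc by one position. On the first cycle the arc consists of ones. On the
second it consists of zeros, so position t is gained and t + m, modulo 2m + 1, is lost. -/
theorem evenThetaVec_succ {k m i : ℕ} (hk : 1 ≤ k) (hm : 1 ≤ m) (hi : i + 1 < 2 * k + 2 * m) :
    evenThetaOut k m i < 2 * k + 2 * m ∧ evenThetaIn k m i < 2 * k + 2 * m ∧
      ∀ c < 2 * k + 2 * m, evenThetaVec k m (i + 1) c = evenThetaVec k m i c +
        (if c = evenThetaIn k m i then 1 else 0) - (if c = evenThetaOut k m i then 1 else 0) := by
  have h0 := fun s => evenThetaCoord_lt (s := s) hk hm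
  refine ⟨?_, ?_, ?_⟩
  · unfold evenThetaOut
    split_ifs
    exacts [by omega, h0 _, h0 _]
  · unfold evenThetaIn
    split_ifs
    exacts [by omega, by omega, h0 _]
  · intro c hc
    rcases lt_or_ge i (2 * k) with h | h
    · simp only [evenThetaIn, evenThetaOut, if_pos h, evenThetaVec_of_le h.le,
        evenThetaVec_of_le (Nat.succ_le_of_lt h)]
      split_ifs <;> omega
    · obtain ⟨t, rfl⟩ := Nat.exists_eq_add_of_le h
      have h4 : ¬ (2 * k + t ≤ k ∧ 2 * k + t < 2 * k) := by omega
      have h5 : 2 * k + t - 2 * k = t := by omega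
      have h6 := evenThetaPos_le hm hc
      rw [add_assoc, evenThetaVec_add hk hm hc, evenThetaVec_add hk hm hc]
      simp only [evenThetaIn, evenThetaOut, if_neg h4, if_neg (not_lt.2 h), h5]
      rw [if_congr (eq_evenThetaCoord_iff (s := t) hk hm hc (by omega)) rfl rfl]
      by_cases h7 : 2 * k + t ≤ 2 * k + m
      · rw [if_pos h7, if_congr (eq_evenThetaCoord_iff (s := t + m) hk hm hc (by omega)) rfl rfl]
        generalize evenThetaPos k m c = p at *
        split_ifs <;> omega
      · rw [if_neg h7,
          if_congr (eq_evenThetaCoord_iff (s := t - m - 1) hk hm hc (by omega)) rfl rfl]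
        generalize evenThetaPos k m c = p at *
        split_ifs <;> omega

theorem evenThetaDist_of_le {k m i j : ℕ} (hi : i ≤ 2 * k) (hj : j ≤ 2 * k) :
    evenThetaDist k m i j = min ((i - j) + (j - i)) (2 * k + 1 - ((i - j) + (j - i))) := by
  rw [evenThetaDist, if_pos hi, if_pos hj]

theorem evenThetaDist_comm (k m i j : ℕ) : evenThetaDist k m i j = evenThetaDist k m j i := by
  unfold evenThetaDist
  split_ifs
  · rw [add_comm (i - j)]
  · rfl
  · rfl
  · rw [add_comm (i - j)]

theorem evenThetaDist_of_le_add {k m i r : ℕ} (hk : 1 ≤ k) (hi : i ≤ 2 * k) (hr : r < 2 * m) :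
    evenThetaDist k m i (2 * k + r) =
      min (min i (2 * k + 1 - i) + (2 * m - r)) (min (2 * k - i) (i + 1) + r) := by
  rcases Nat.eq_zero_or_pos r with rfl | hr0
  · rw [evenThetaDist, if_pos hi, if_pos (by omega)]
    omega
  · rw [evenThetaDist, if_pos hi, if_neg (by omega)]
    omega

theorem evenThetaDist_add_add {k m t r : ℕ} (hk : 1 ≤ k) (ht : t < 2 * m) (hr : r < 2 * m) :
    evenThetaDist k m (2 * k + t) (2 * k + r) =
      min ((t - r) + (r - t)) (2 * m + 1 - ((t - r) + (r - t))) := by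
  rcases Nat.eq_zero_or_pos t with rfl | ht0
  · rw [add_zero, evenThetaDist_of_le_add hk le_rfl hr]
    omega
  · rcases Nat.eq_zero_or_pos r with rfl | hr0
    · rw [add_zero, evenThetaDist_comm, evenThetaDist_of_le_add hk le_rfl ht]
      omega
    · rw [evenThetaDist, if_neg (by omega), if_neg (by omega)]
      omega

theorem evenThetaVec_coord {k m t s : ℕ} (hk : 1 ≤ k) (hm : 1 ≤ m) (hs : s ≤ 2 * m) :
    evenThetaVec k m (2 * k + t) (evenThetaCoord k m s) =
      if t ≤ s ∧ s < t + m ∨ s + m + 1 < t then 0 else 1 := by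
  obtain ⟨h1, h2, h3⟩ := (eq_evenThetaCoord_iff hk hm (evenThetaCoord_lt hk hm) hs).1 rfl
  rw [evenThetaVec_add hk hm (evenThetaCoord_lt hk hm), if_neg h1, if_neg h2, h3]

theorem evenThetaVec_coord_of_le {k m i s : ℕ} (hk : 1 ≤ k) (hi : i ≤ 2 * k) :
    evenThetaVec k m i (evenThetaCoord k m s) =
      if s + 1 < m then 0 else if s + 1 = m then (if i < k then 1 else 0)
      else if s < 2 * m then 1 else if i ≤ k then 0 else 1 := by
  rw [evenThetaVec_of_le hi]
  unfold evenThetaCoord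
  split_ifs <;> omega

theorem evenThetaVec_add_of_le {k m t c : ℕ} (hk : 1 ≤ k) (hm : 1 ≤ m) (hc : c ≤ 2 * k)
    (ht : t < 2 * m) : evenThetaVec k m (2 * k + t) c =
      if c + 1 < k then 1 else if c + 1 = k then (if t < m then 0 else 1)
      else if c < 2 * k then 0 else if t ≤ m then 1 else 0 := by
  rw [evenThetaVec_add hk hm (by omega)]
  unfold evenThetaPos
  split_ifs <;> omega

theorem evenThetaDist_sub_of_le_of_lt {k m i j : ℕ} (hi : i ≤ 2 * k) (hj : j < 2 * k) :
    (evenThetaDist k m i j : ℤ) - evenThetaDist k m i (j + 1) =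
      evenThetaVec k m i (evenThetaIn k m j) - evenThetaVec k m i (evenThetaOut k m j) := by
  rw [evenThetaVec_of_le hi, evenThetaVec_of_le hi, evenThetaDist_of_le hi hj.le,
    evenThetaDist_of_le hi hj]
  simp only [evenThetaIn, evenThetaOut, if_pos hj]
  split_ifs <;> omega

theorem evenThetaDist_sub_add_of_lt {k m t j : ℕ} (hk : 1 ≤ k) (hm : 1 ≤ m) (ht : t < 2 * m)
    (hj : j < 2 * k) :
    (evenThetaDist k m (2 * k + t) j : ℤ) - evenThetaDist k m (2 * k + t) (j + 1) =
      evenThetaVec k m (2 * k + t) (evenThetaIn k m j) -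
        evenThetaVec k m (2 * k + t) (evenThetaOut k m j) := by
  rw [evenThetaDist_comm, evenThetaDist_of_le_add hk hj.le ht, evenThetaDist_comm k m _ (j + 1),
    evenThetaDist_of_le_add hk hj ht]
  simp only [evenThetaIn, evenThetaOut, if_pos hj]
  rw [evenThetaVec_add_of_le hk hm hj.le ht,
    evenThetaVec_add_of_le hk hm (by split_ifs <;> omega) ht]
  by_cases h1 : j ≤ k ∧ j < 2 * k
  · simp only [if_pos h1]
    rcases lt_or_ge t m with h2 | h2 <;> rcases lt_trichotomy (j + 1) k with h3 | h3 | h3 <;>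
    simp (disch := omega) only [min_eq_left, min_eq_right, if_pos, if_neg] <;>
    (try split_ifs) <;> omega
  · simp only [if_neg h1]
    rcases lt_or_ge t m with h2 | h2 <;>
    simp (disch := omega) only [min_eq_left, min_eq_right, if_pos, if_neg] <;>
    omega

theorem evenThetaDist_sub_of_le_add {k m i r : ℕ} (hk : 1 ≤ k) (hi : i ≤ 2 * k)
    (hr : r + 1 < 2 * m) :
    (evenThetaDist k m i (2 * k + r) : ℤ) - evenThetaDist k m i (2 * k + (r + 1)) =
      evenThetaVec k m i (evenThetaIn k m (2 * k + r)) -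
        evenThetaVec k m i (evenThetaOut k m (2 * k + r)) := by
  have h1 : ¬ (2 * k + r ≤ k ∧ 2 * k + r < 2 * k) := by omega
  have h2 : 2 * k + r - 2 * k = r := by omega
  have h3 : ¬ 2 * k + r < 2 * k := by omega
  simp only [evenThetaIn, evenThetaOut, if_neg h1, if_neg h3, h2]
  rw [evenThetaDist_of_le_add hk hi (by omega), evenThetaDist_of_le_add hk hi hr]
  by_cases h3 : 2 * k + r ≤ 2 * k + m
  · rw [if_pos h3, evenThetaVec_coord_of_le hk hi, evenThetaVec_coord_of_le hk hi]
    split_ifs <;> omega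
  · rw [if_neg h3, evenThetaVec_coord_of_le hk hi, evenThetaVec_coord_of_le hk hi]
    split_ifs <;> omega

theorem evenThetaDist_sub_add_add {k m t r : ℕ} (hk : 1 ≤ k) (hm : 1 ≤ m) (ht : t < 2 * m)
    (hr : r + 1 < 2 * m) :
    (evenThetaDist k m (2 * k + t) (2 * k + r) : ℤ) -
        evenThetaDist k m (2 * k + t) (2 * k + (r + 1)) =
      evenThetaVec k m (2 * k + t) (evenThetaIn k m (2 * k + r)) -
        evenThetaVec k m (2 * k + t) (evenThetaOut k m (2 * k + r)) := by
  have h1 : ¬ (2 * k + r ≤ k ∧ 2 * k + r < 2 * k) := by omega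
  have h2 : 2 * k + r - 2 * k = r := by omega
  have h3 : ¬ 2 * k + r < 2 * k := by omega
  simp only [evenThetaIn, evenThetaOut, if_neg h1, if_neg h3, h2]
  rw [evenThetaDist_add_add hk ht (by omega), evenThetaDist_add_add hk ht hr]
  by_cases h3 : 2 * k + r ≤ 2 * k + m
  · rw [if_pos h3, evenThetaVec_coord hk hm (by omega), evenThetaVec_coord hk hm (by omega)]
    split_ifs <;> omega
  · rw [if_neg h3, evenThetaVec_coord hk hm (by omega), evenThetaVec_coord hk hm (by omega)]
    split_ifs <;> omega

/-- Comparing one-step differences avoids computing intersections of arcs; the cases record which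
cycle contains i and which contains the step from j. -/
theorem evenThetaDist_sub {k m i j : ℕ} (hk : 1 ≤ k) (hm : 1 ≤ m) (hi : i < 2 * k + 2 * m)
    (hj : j + 1 < 2 * k + 2 * m) :
    (evenThetaDist k m i j : ℤ) - evenThetaDist k m i (j + 1) =
      evenThetaVec k m i (evenThetaIn k m j) - evenThetaVec k m i (evenThetaOut k m j) := by
  rcases le_or_gt i (2 * k) with h' | h' <;> rcases lt_or_ge j (2 * k) with h | h
  · exact evenThetaDist_sub_of_le_of_lt h' h
  · obtain ⟨r, rfl⟩ := Nat.exists_eq_add_of_le h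
    exact evenThetaDist_sub_of_le_add hk h' (by omega)
  · obtain ⟨t, rfl⟩ := Nat.exists_eq_add_of_le h'.le
    exact evenThetaDist_sub_add_of_lt hk hm (by omega) h
  · obtain ⟨t, rfl⟩ := Nat.exists_eq_add_of_le h'.le
    obtain ⟨r, rfl⟩ := Nat.exists_eq_add_of_le h
    exact evenThetaDist_sub_add_add hk hm (by omega) (by omega)

theorem sum_evenThetaVec_zero (k m : ℕ) :
    ∑ c ∈ Finset.range (2 * k + 2 * m), evenThetaVec k m 0 c = (k + m : ℕ) := by
  have h1 : ∀ c ∈ Finset.range (2 * k + 2 * m), evenThetaVec k m 0 c =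
      if c ∈ Finset.range k ∪ Finset.Ico (2 * k + m) (2 * k + 2 * m) then 1 else 0 := by
    intro c hc
    simp only [Finset.mem_union, Finset.mem_range, Finset.mem_Ico] at hc ⊢
    rw [evenThetaVec_of_le (Nat.zero_le _)]
    split_ifs <;> omega
  have h2 : Finset.range (2 * k + 2 * m) ∩
      (Finset.range k ∪ Finset.Ico (2 * k + m) (2 * k + 2 * m)) =
      Finset.range k ∪ Finset.Ico (2 * k + m) (2 * k + 2 * m) := by
    ext c
    simp only [Finset.mem_inter, Finset.mem_union, Finset.mem_range, Finset.mem_Ico]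
    omega
  have h3 : Disjoint (Finset.range k) (Finset.Ico (2 * k + m) (2 * k + 2 * m)) := by
    rw [Finset.disjoint_left]
    intro c
    simp only [Finset.mem_range, Finset.mem_Ico]
    omega
  rw [Finset.sum_congr rfl h1, Finset.sum_ite_mem, h2, Finset.sum_const, nsmul_eq_mul, mul_one,
    Finset.card_union_of_disjoint h3, Finset.card_range, Nat.card_Ico]
  congr 1
  omega

/-- The two arcs of length k following c are disjoint and cover every position of the first cycle
except c. Differences of such sums isolate coordinates. -/
theorem evenThetaVec_pair_of_le {k m u v c e : ℕ} (hc : c ≤ 2 * k)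
    (h : c < k ∧ u = c + 1 ∧ v = c + 1 + k ∨ k ≤ c ∧ c < 2 * k ∧ u = c - k ∧ v = c + 1 ∨
      c = 2 * k ∧ u = k ∧ v = 0) :
    evenThetaVec k m u e + evenThetaVec k m v e =
      if e ≤ 2 * k then (if e = c then 0 else 1) else if 2 * k + m ≤ e then 2 else 0 := by
  rw [evenThetaVec_of_le (by omega), evenThetaVec_of_le (by omega)]
  split_ifs <;> omega

theorem evenThetaVec_pair_of_lt {k m u v s e : ℕ} (hk : 1 ≤ k) (hm : 1 ≤ m)
    (he : e < 2 * k + 2 * m)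
    (h : s + 1 < m ∧ u = s + 1 ∧ v = s + 1 + m ∨ m ≤ s ∧ s + 1 < 2 * m ∧ u = s - m ∧ v = s + 1 ∨
      s = 2 * m ∧ u = m ∧ v = 0) :
    evenThetaVec k m (2 * k + u) e + evenThetaVec k m (2 * k + v) e =
      (if e + 1 < k then 2 else if k ≤ e ∧ e < 2 * k then 0 else 1) +
        if e = evenThetaCoord k m s then 1 else 0 := by
  have h1 := evenThetaPos_le hm he
  rw [evenThetaVec_add hk hm he, evenThetaVec_add hk hm he,
    if_congr (eq_evenThetaCoord_iff (s := s) hk hm he (by omega)) rfl rfl]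
  generalize evenThetaPos k m e = p at *
  split_ifs <;> omega

/-- For s = 2m - 1 the second arc would belong to t = 2m, which is the endpoint A and is numbered 0.
-/
theorem evenThetaVec_pair_last {k m e : ℕ} (hk : 1 ≤ k) (hm : 1 ≤ m) (he : e < 2 * k + 2 * m) :
    evenThetaVec k m (2 * k + (m - 1)) e + evenThetaVec k m 0 e =
      (if e + 1 < k then 2 else if k ≤ e ∧ e < 2 * k then 0 else 1) +
        if e = evenThetaCoord k m (2 * m - 1) then 1 else 0 := by
  rw [evenThetaVec_add hk hm he, evenThetaVec_of_le (Nat.zero_le _)]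
  unfold evenThetaPos evenThetaCoord
  split_ifs <;> omega

theorem evenThetaVec_span {k m c : ℕ} (hk : 1 ≤ k) (hm : 1 ≤ m) (hc : c < 2 * k + 2 * m) :
    ∃ u < 2 * k + 2 * m, ∃ v < 2 * k + 2 * m, ∃ u' < 2 * k + 2 * m, ∃ v' < 2 * k + 2 * m,
      ∀ e < 2 * k + 2 * m, evenThetaVec k m u e + evenThetaVec k m v e - evenThetaVec k m u' e -
        evenThetaVec k m v' e = (if e = c then 1 else 0) - (if e = 2 * k then 1 else 0) := by
  rcases le_or_gt c (2 * k) with h | h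
  · obtain ⟨u, v, huv⟩ : ∃ u v, c < k ∧ u = c + 1 ∧ v = c + 1 + k ∨
        k ≤ c ∧ c < 2 * k ∧ u = c - k ∧ v = c + 1 ∨ c = 2 * k ∧ u = k ∧ v = 0 := by
      rcases lt_or_ge c k with h1 | h1
      · exact ⟨_, _, Or.inl ⟨h1, rfl, rfl⟩⟩
      · rcases lt_or_eq_of_le h with h2 | h2
        · exact ⟨_, _, Or.inr (Or.inl ⟨h1, h2, rfl, rfl⟩)⟩
        · exact ⟨_, _, Or.inr (Or.inr ⟨h2, rfl, rfl⟩)⟩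
    refine ⟨k, by omega, 0, by omega, u, by omega, v, by omega, fun e he => ?_⟩
    have h1 := evenThetaVec_pair_of_le (m := m) (e := e) h huv
    have h2 := evenThetaVec_pair_of_le (m := m) (c := 2 * k) (e := e) le_rfl
      (Or.inr (Or.inr ⟨rfl, rfl, rfl⟩))
    rw [sub_sub, h1, h2]
    split_ifs <;> omega
  · have h0 : evenThetaCoord k m (2 * m) = 2 * k := by
      unfold evenThetaCoord
      split_ifs <;> omega
    obtain ⟨s, rfl, hs⟩ : ∃ s, c = evenThetaCoord k m s ∧ (s + 1 < m ∨ m ≤ s ∧ s < 2 * m) := by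
      refine ⟨evenThetaPos k m c,
        (eq_evenThetaCoord_iff hk hm hc (evenThetaPos_le hm hc)).2 ⟨by omega, by omega, rfl⟩, ?_⟩
      unfold evenThetaPos
      split_ifs <;> omega
    have h2 := fun {e} (he : e < 2 * k + 2 * m) => evenThetaVec_pair_of_lt (s := 2 * m) hk hm he
      (Or.inr (Or.inr ⟨rfl, rfl, rfl⟩))
    rw [h0] at h2
    by_cases hs' : s + 1 = 2 * m
    · obtain rfl : s = 2 * m - 1 := by omega
      refine ⟨2 * k + (m - 1), by omega, 0, by omega, 2 * k + m, by omega, 2 * k + 0, by omega,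
        fun e he => ?_⟩
      rw [sub_sub, evenThetaVec_pair_last hk hm he, h2 he]
      ring
    · obtain ⟨u, v, huv⟩ : ∃ u v, s + 1 < m ∧ u = s + 1 ∧ v = s + 1 + m ∨
          m ≤ s ∧ s + 1 < 2 * m ∧ u = s - m ∧ v = s + 1 ∨ s = 2 * m ∧ u = m ∧ v = 0 := by
        rcases hs with h1 | h1
        · exact ⟨_, _, Or.inl ⟨h1, rfl, rfl⟩⟩
        · exact ⟨_, _, Or.inr (Or.inl ⟨h1.1, by omega, rfl, rfl⟩)⟩
      refine ⟨2 * k + u, by omega, 2 * k + v, by omega, 2 * k + m, by omega, 2 * k + 0, by omega,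
        fun e he => ?_⟩
      rw [sub_sub, evenThetaVec_pair_of_lt hk hm he huv, h2 he]
      ring

theorem det_evenThetaDist {k m : ℕ} (hk : 1 ≤ k) (hm : 1 ≤ m) :
    (Matrix.of fun i j : Fin (2 * k + 2 * m) => (evenThetaDist k m i j : ℚ)).det =
      -((k : ℚ) + m) ^ 2 := by
  have h := det_of_subset_embedding (n := 2 * k + 2 * m) (by omega) (h := (k + m : ℕ))
    (by omega) (fun i j => evenThetaDist k m i j) (evenThetaVec k m) (evenThetaOut k m)
    (evenThetaIn k m) (fun i hi => evenThetaVec_succ hk hm hi) (sum_evenThetaVec_zero k m)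
    (fun c _ => by rw [evenThetaVec_of_le (Nat.zero_le _)]; split_ifs <;> rfl)
    (by simp [evenThetaDist]) (fun i _ => by rw [evenThetaDist_comm])
    (fun i hi j hj => evenThetaDist_sub hk hm hi hj) (2 * k) (by omega)
    (fun c hc => evenThetaVec_span hk hm hc)
  have h2 : (-1 : ℚ) ^ (2 * k + 2 * m) = 1 := Even.neg_one_pow ⟨k + m, by ring⟩
  simp only [Int.cast_natCast] at h
  rw [h, h2]
  push_cast
  ring

/-! ### Enumerating the vertices, and case (a) -/

theorem card_thetaVertex (L : Fin 3 → ℕ) :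
    Fintype.card (ThetaVertex L) = 2 + ∑ i, (L i - 1) := by
  simp [Fintype.card_sum, Fintype.card_sigma]

/-- Indices with the same image have d = 0, so the enumeration is injective, and counting makes it
bijective; no inverse has to be constructed. -/
theorem det_distanceMatrix_of_dist {V ι : Type*} [Fintype V] [DecidableEq V] [Fintype ι]
    [DecidableEq ι] (G : SimpleGraph V) (e : ι → V) (d : ι → ι → ℕ)
    (hcard : Fintype.card ι = Fintype.card V) (hd : ∀ i j, G.dist (e i) (e j) = d i j)
    (hd0 : ∀ i j, d i j = 0 → i = j) :
    (distanceMatrix G).det = (Matrix.of fun i j => (d i j : ℚ)).det := by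
  have hinj : Function.Injective e := by
    intro i j hij
    apply hd0
    rw [← hd, hij, SimpleGraph.dist_self]
  have hbij : Function.Bijective e :=
    (Fintype.bijective_iff_injective_and_card e).2 ⟨hinj, hcard⟩
  rw [← Matrix.det_submatrix_equiv_self (Equiv.ofBijective e hbij) (distanceMatrix G)]
  congr 1
  ext i j
  simp [distanceMatrix, hd]

theorem sum_fin_three {i j k : Fin 3} (hij : i ≠ j) (hik : i ≠ k) (hjk : j ≠ k) (f : Fin 3 → ℕ) :
    ∑ x, f x = f i + f j + f k := by
  have h : (Finset.univ : Finset (Fin 3)) = {i, j, k} := by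
    revert i j k
    decide
  rw [h, Finset.sum_insert (by simp [hij, hik]), Finset.sum_insert (by simp [hjk]),
    Finset.sum_singleton, add_assoc]

theorem eq_of_fin_three {i j k : Fin 3} (hij : i ≠ j) (hik : i ≠ k) (hjk : j ≠ k) (x : Fin 3) :
    x = i ∨ x = j ∨ x = k := by
  revert i j k x
  decide

theorem det_theta_one_even_even {L : Fin 3 → ℕ} {c i j : Fin 3} (hci : c ≠ i) (hcj : c ≠ j)
    (hij : i ≠ j) {k m : ℕ} (hk : 1 ≤ k) (hm : 1 ≤ m) (hLc : L c = 1) (hLi : L i = 2 * k)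
    (hLj : L j = 2 * m) : (distanceMatrix (thetaGraphOf L)).det = -((k : ℚ) + m) ^ 2 := by
  have hL : ∀ x, 1 ≤ L x := by
    intro x
    rcases eq_of_fin_three hci hcj hij x with rfl | rfl | rfl <;> omega
  have hc : ∀ x, L c ≤ L x := fun x => hLc ▸ hL x
  rw [← det_evenThetaDist hk hm]
  refine det_distanceMatrix_of_dist _ (fun x : Fin (2 * k + 2 * m) => if (x : ℕ) ≤ 2 * k then
    thetaPoint L i x else thetaPoint L j (2 * k + 2 * m - x))
    (fun x y => evenThetaDist k m x y) ?_ ?_ ?_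
  · rw [Fintype.card_fin, card_thetaVertex, sum_fin_three hci hcj hij]
    omega
  · rintro ⟨x, hx⟩ ⟨y, hy⟩
    simp only [evenThetaDist]
    split_ifs with h1 h2 h2
    all_goals
      rw [dist_thetaPoint hL hc (by omega) (by omega)]
      simp only [thetaDist, hLc, hLi, hLj, hij, hij.symm, if_true, if_false]
      omega
  · rintro ⟨x, hx⟩ ⟨y, hy⟩ h
    simp only [evenThetaDist, Fin.mk.injEq] at h ⊢
    split_ifs at h <;> omega

/-! ### Odd cycles, twin vertices and case (c) -/

/-- Distances in the cycle with `n` vertices. -/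
def cycleDist (n i j : ℕ) : ℕ := min ((i - j) + (j - i)) (n - ((i - j) + (j - i)))

theorem cycleDist_comm (n i j : ℕ) : cycleDist n i j = cycleDist n j i := by
  rw [cycleDist, cycleDist, add_comm (i - j)]

theorem sum_cycleDist_succ {n i : ℕ} (hi : i < n) :
    ∑ j ∈ Finset.range (n + 1), cycleDist (n + 1) (i + 1) j =
      ∑ j ∈ Finset.range (n + 1), cycleDist (n + 1) i j := by
  rw [Finset.sum_range_succ', Finset.sum_range_succ]
  congr 1
  · refine Finset.sum_congr rfl fun j _ => ?_
    simp only [cycleDist]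
    congr 2 <;> omega
  · simp only [cycleDist]
    omega

theorem sum_cycleDist_zero (k : ℕ) :
    ∑ j ∈ Finset.range (2 * k + 1), cycleDist (2 * k + 1) 0 j = k * (k + 1) := by
  have h1 : ∑ j ∈ Finset.range (k + 1), cycleDist (2 * k + 1) 0 j =
      ∑ j ∈ Finset.range (k + 1), j := by
    refine Finset.sum_congr rfl fun j hj => ?_
    rw [Finset.mem_range] at hj
    simp only [cycleDist]
    omega
  have h2 : ∑ j ∈ Finset.range k, cycleDist (2 * k + 1) 0 (k + 1 + j) =
      ∑ j ∈ Finset.range k, (k - 1 - j + 1) := by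
    refine Finset.sum_congr rfl fun j hj => ?_
    rw [Finset.mem_range] at hj
    simp only [cycleDist]
    omega
  have h3 := Finset.sum_range_succ' (fun j => j) k
  rw [show 2 * k + 1 = k + 1 + k by ring, Finset.sum_range_add]
  rw [show k + 1 + k = 2 * k + 1 by ring, h1, h2, Finset.sum_range_reflect (fun j => j + 1) k]
  simp only [add_zero] at h3
  rw [← h3]
  have h4 := Finset.sum_range_id_mul_two (k + 1)
  simp only [add_tsub_cancel_right] at h4
  linarith

theorem sum_cycleDist {k i : ℕ} (hi : i < 2 * k + 1) :
    ∑ j ∈ Finset.range (2 * k + 1), cycleDist (2 * k + 1) i j = k * (k + 1) := by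
  induction i with
  | zero => exact sum_cycleDist_zero k
  | succ i ih => rw [sum_cycleDist_succ (by omega), ih (by omega)]

/-- The indicator function of `k` cyclically consecutive elements, the first one being `i`, among
`0, …, 2 * k`. -/
def arcVec (k i c : ℕ) : ℤ := if i ≤ c ∧ c < i + k ∨ c + k + 1 < i then 1 else 0

theorem arcVec_span {k c : ℕ} (hc : c < 2 * k + 1) :
    ∃ u < 2 * k + 1, ∃ v < 2 * k + 1, ∃ u' < 2 * k + 1, ∃ v' < 2 * k + 1, ∀ e < 2 * k + 1,
      arcVec k u e + arcVec k v e - arcVec k u' e - arcVec k v' e =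
        (if e = c then 1 else 0) - (if e = 2 * k then 1 else 0) := by
  obtain ⟨u, v, huv⟩ : ∃ u v, c < k ∧ u = c + 1 ∧ v = c + 1 + k ∨
      k ≤ c ∧ c < 2 * k ∧ u = c - k ∧ v = c + 1 ∨ c = 2 * k ∧ u = k ∧ v = 0 := by
    rcases lt_or_ge c k with h1 | h1
    · exact ⟨_, _, Or.inl ⟨h1, rfl, rfl⟩⟩
    · rcases lt_or_eq_of_le (Nat.lt_succ_iff.1 hc) with h2 | h2
      · exact ⟨_, _, Or.inr (Or.inl ⟨h1, h2, rfl, rfl⟩)⟩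
      · exact ⟨_, _, Or.inr (Or.inr ⟨h2, rfl, rfl⟩)⟩
  have h2 : ∀ e < 2 * k + 1, arcVec k u e + arcVec k v e = if e = c then 0 else 1 := by
    intro e he
    simp only [arcVec]
    split_ifs <;> omega
  have h3 : ∀ e < 2 * k + 1, arcVec k k e + arcVec k 0 e = if e = 2 * k then 0 else 1 := by
    intro e he
    simp only [arcVec]
    split_ifs <;> omega
  refine ⟨k, by omega, 0, by omega, u, by omega, v, by omega, fun e he => ?_⟩
  rw [sub_sub, h2 e he, h3 e he]
  split_ifs <;> omega

/-- The determinant of the distance matrix of an odd cycle. -/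
theorem det_cycleDist {k : ℕ} (hk : 1 ≤ k) :
    (Matrix.of fun i j : Fin (2 * k + 1) => (cycleDist (2 * k + 1) i j : ℚ)).det =
      k * (k + 1) := by
  have hstep : ∀ i, i + 1 < 2 * k + 1 → i < 2 * k + 1 ∧
      (if i ≤ k then i + k else i - k - 1) < 2 * k + 1 ∧ ∀ c < 2 * k + 1,
      arcVec k (i + 1) c = arcVec k i c + (if c = if i ≤ k then i + k else i - k - 1 then 1 else 0)
        - (if c = i then 1 else 0) := by
    intro i hi
    refine ⟨by omega, by split_ifs <;> omega, fun c hc => ?_⟩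
    simp only [arcVec]
    split_ifs <;> omega
  have hsum : ∑ c ∈ Finset.range (2 * k + 1), arcVec k 0 c = (k : ℤ) := by
    have h1 : ∀ c ∈ Finset.range (2 * k + 1), arcVec k 0 c =
        if c ∈ Finset.range k then 1 else 0 := by
      intro c _
      simp [arcVec]
    have h2 : Finset.range (2 * k + 1) ∩ Finset.range k = Finset.range k :=
      Finset.inter_eq_right.2 (Finset.range_subset_range.2 (by omega))
    rw [Finset.sum_congr rfl h1, Finset.sum_ite_mem, h2]
    simp
  have h := det_of_subset_embedding (n := 2 * k + 1) (by omega) (h := k)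
    (by omega) (fun i j => cycleDist (2 * k + 1) i j) (arcVec k) (fun i => i)
    (fun i => if i ≤ k then i + k else i - k - 1) hstep hsum
    (fun c _ => by simp only [arcVec]; split_ifs <;> rfl)
    (by simp [cycleDist]) (fun i _ => by rw [cycleDist_comm])
    (fun i hi j hj => by
      simp only [arcVec, cycleDist]
      split_ifs <;> omega)
    (2 * k) (by omega) (fun c hc => arcVec_span hc)
  have h2 : (-1 : ℚ) ^ (2 * k + 1) = -1 := Odd.neg_one_pow ⟨k, rfl⟩
  simp only [Int.cast_natCast] at h
  rw [h, h2]
  push_cast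
  ring

/-- Adding to a graph with distance matrix `D` a second copy of a vertex, at distance `2` from the
first one. -/
theorem Matrix.det_fromBlocks_twin {ι : Type*} [Fintype ι] [DecidableEq ι] (D : Matrix ι ι ℚ)
    (hD : D.transpose = D) {x : ι} (hx : D x x = 0) {z : ι → ℚ}
    (hz : D.mulVec z = Pi.single x 1) :
    (Matrix.fromBlocks 0 (Matrix.replicateRow Unit (D x + Pi.single x 2))
      -- The twin has the distances of x to all other vertices, but distance 2 instead of 0 to x
      -- itself.
      (Matrix.replicateCol Unit (D x + Pi.single x 2)) D).det = -4 * (1 + z x) * D.det := by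
  set w : ι → ℚ := D x + Pi.single x 2 with hw
  set y : ι → ℚ := Pi.single x 1 + (2 : ℚ) • z with hy
  have hDy : D.mulVec y = w := by
    rw [hy, Matrix.mulVec_add, Matrix.mulVec_smul, hz, Matrix.mulVec_single_one, hw]
    congr 1
    · ext i
      exact congrFun (congrFun hD x) i
    · ext i
      simp [Pi.single_apply]
  have hwy : w ⬝ᵥ y = 4 * (1 + z x) := by
    have h1 : D x ⬝ᵥ z = 1 := by
      have := congrFun hz x
      rwa [Pi.single_eq_same] at this
    rw [hw, hy, add_dotProduct, dotProduct_add, dotProduct_smul, h1, dotProduct_single,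
      single_dotProduct, hx]
    simp
    ring
  have hmul : Matrix.fromBlocks 0 (Matrix.replicateRow Unit w) (Matrix.replicateCol Unit w) D *
      Matrix.fromBlocks 1 0 (Matrix.replicateCol Unit (-y)) 1 =
      Matrix.fromBlocks (Matrix.of fun _ _ : Unit => -(w ⬝ᵥ y)) (Matrix.replicateRow Unit w) 0
        D := by
    rw [Matrix.fromBlocks_multiply]
    congr 1
    · ext i j
      simp [Matrix.mul_apply, dotProduct]
    · simp
    · ext i j
      have := congrFun hDy i
      simp only [Matrix.mulVec, dotProduct] at this
      simp [Matrix.mul_apply, this]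
    · simp
  have hdet := congrArg Matrix.det hmul
  rw [Matrix.det_mul, Matrix.det_fromBlocks_zero₁₂, Matrix.det_fromBlocks_zero₂₁] at hdet
  simp only [Matrix.det_one, mul_one, Matrix.det_unique (Matrix.of _), Matrix.of_apply,
    hwy] at hdet
  rw [hdet]
  ring

/-- All row sums are k(k + 1). The vertices k - 1 and k are the two farthest from x = 2k, so d(i, k
- 1) + d(i, k) + 2 d(i, x) is 2k + 1 for i ≠ x and 2k for i = x. -/
theorem cycleDist_mulVec {k : ℕ} (hk : 1 ≤ k) :
    (Matrix.of fun i j : Fin (2 * k + 1) => (cycleDist (2 * k + 1) i j : ℚ)).mulVec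
      ((((2 * k + 1 : ℚ) / (k * (k + 1))) • fun _ => (1 : ℚ)) -
        (2 : ℚ) • Pi.single (⟨2 * k, by omega⟩ : Fin (2 * k + 1)) (1 : ℚ) -
        Pi.single ⟨k - 1, by omega⟩ 1 - Pi.single ⟨k, by omega⟩ 1) =
      Pi.single ⟨2 * k, by omega⟩ 1 := by
  have hk0 : (k : ℚ) ≠ 0 := by positivity
  ext ⟨i, hi⟩
  have h1 : (Matrix.of fun i j : Fin (2 * k + 1) => (cycleDist (2 * k + 1) i j : ℚ)).mulVec
      (fun _ => 1) ⟨i, hi⟩ = k * (k + 1) := by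
    have := sum_cycleDist hi
    rw [Finset.sum_range] at this
    simp only [Matrix.mulVec, dotProduct, Matrix.of_apply, mul_one]
    exact_mod_cast this
  rw [Matrix.mulVec_sub, Matrix.mulVec_sub, Matrix.mulVec_sub, Matrix.mulVec_smul,
    Matrix.mulVec_smul]
  simp only [Pi.sub_apply, Pi.smul_apply, h1, Matrix.mulVec_single_one, Matrix.col_apply,
    Matrix.of_apply, smul_eq_mul]
  rw [div_mul_cancel₀ _ (by positivity), Pi.single_apply]
  simp only [Fin.mk.injEq]
  have h2 : (2 * k + 1 : ℤ) - 2 * cycleDist (2 * k + 1) i (2 * k) -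
      cycleDist (2 * k + 1) i (k - 1) - cycleDist (2 * k + 1) i k =
      if i = 2 * k then 1 else 0 := by
    simp only [cycleDist]
    split_ifs <;> omega
  exact_mod_cast h2

theorem det_theta_two_two_odd {L : Fin 3 → ℕ} {a b q : Fin 3} (hab : a ≠ b) (haq : a ≠ q)
    (hbq : b ≠ q) {k : ℕ} (hk : 2 ≤ k) (hLa : L a = 2) (hLb : L b = 2) (hLq : L q = 2 * k - 1) :
    (distanceMatrix (thetaGraphOf L)).det = (2 * (k : ℚ) - 1) ^ 2 - 5 := by
  have hL : ∀ x, 1 ≤ L x := by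
    intro x
    rcases eq_of_fin_three hab haq hbq x with rfl | rfl | rfl <;> omega
  have ha : ∀ x, L a ≤ L x := by
    intro x
    rcases eq_of_fin_three hab haq hbq x with rfl | rfl | rfl <;> omega
  have hk0 : (k : ℚ) ≠ 0 := by positivity
  set D : Matrix (Fin (2 * k + 1)) (Fin (2 * k + 1)) ℚ :=
    Matrix.of fun i j => (cycleDist (2 * k + 1) i j : ℚ) with hD
  have htwin := Matrix.det_fromBlocks_twin D
    (by ext i j; simp only [hD, Matrix.transpose_apply, Matrix.of_apply, cycleDist_comm])
    (x := ⟨2 * k, by omega⟩) (by simp only [hD, Matrix.of_apply, cycleDist]; simp) (cycleDist_mulVec (by omega))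
  have hz : (1 : ℚ) + ((((2 * k + 1 : ℚ) / (k * (k + 1))) • fun _ => (1 : ℚ)) -
        (2 : ℚ) • Pi.single (⟨2 * k, by omega⟩ : Fin (2 * k + 1)) (1 : ℚ) -
        Pi.single ⟨k - 1, by omega⟩ 1 - Pi.single ⟨k, by omega⟩ 1 : Fin (2 * k + 1) → ℚ)
        ⟨2 * k, by omega⟩ = (2 * k + 1) / (k * (k + 1)) - 1 := by
    have h1 : 2 * k ≠ k - 1 := by omega
    have h2 : 2 * k ≠ k := by omega
    simp only [Pi.sub_apply, Pi.smul_apply, Pi.single_apply, Fin.mk.injEq, if_true, if_neg h1,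
      if_neg h2, smul_eq_mul]
    ring
  rw [hz, hD, det_cycleDist (by omega)] at htwin
  have hval : -4 * ((2 * k + 1) / (k * (k + 1)) - 1) * ((k : ℚ) * (k + 1)) =
      (2 * (k : ℚ) - 1) ^ 2 - 5 := by
    field_simp
    ring
  rw [← hval, ← htwin]
  let d : Unit ⊕ Fin (2 * k + 1) → Unit ⊕ Fin (2 * k + 1) → ℕ
    | Sum.inl _, Sum.inl _ => 0
    | Sum.inl _, Sum.inr y => if (y : ℕ) = 2 * k then 2 else cycleDist (2 * k + 1) (2 * k) y
    | Sum.inr x, Sum.inl _ => if (x : ℕ) = 2 * k then 2 else cycleDist (2 * k + 1) (2 * k) x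
    | Sum.inr x, Sum.inr y => cycleDist (2 * k + 1) x y
  -- The paths `q` and `b` form the cycle of length 2k + 1, with the middle of `b` numbered 2k; the
  -- middle of `a` is its twin.
  rw [det_distanceMatrix_of_dist (thetaGraphOf L) (Sum.elim (fun _ : Unit => thetaPoint L a 1)
    fun x : Fin (2 * k + 1) => if (x : ℕ) = 2 * k then thetaPoint L b 1 else thetaPoint L q x)
    d ?_ ?_ ?_]
  · congr 1
    ext (_ | ⟨x, hx⟩) (_ | ⟨y, hy⟩)
    · simp [d]
    · simp only [d, Matrix.of_apply, Matrix.fromBlocks_apply₁₂, Matrix.replicateRow_apply,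
        Pi.add_apply, Pi.single_apply, Fin.mk.injEq, cycleDist]
      split_ifs with h
      · subst h; simp
      · simp
    · simp only [d, Matrix.of_apply, Matrix.fromBlocks_apply₂₁, Matrix.replicateCol_apply,
        Pi.add_apply, Pi.single_apply, Fin.mk.injEq, cycleDist]
      split_ifs with h
      · subst h; simp
      · simp
    · simp [d]
  · rw [Fintype.card_sum, Fintype.card_fin, card_thetaVertex, sum_fin_three hab haq hbq,
      Fintype.card_unit]
    omega
  · rintro (_ | ⟨x, hx⟩) (_ | ⟨y, hy⟩)
    all_goals
      simp only [Sum.elim_inl, Sum.elim_inr, d]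
      try split_ifs
      all_goals
        rw [dist_thetaPoint hL ha (by omega) (by omega)]
        simp only [thetaDist, hLa, hLb, hLq, hab, hab.symm, haq, hbq, haq.symm, hbq.symm, if_true,
          if_false, cycleDist]
        omega
  · rintro (_ | ⟨x, hx⟩) (_ | ⟨y, hy⟩) h
    · rfl
    · simp only [d, cycleDist] at h
      split_ifs at h; omega
    · simp only [d, cycleDist] at h
      split_ifs at h; omega
    · simp only [d, cycleDist] at h
      simp only [Sum.inr.injEq, Fin.mk.injEq]
      omega

/-! ### Case (b) -/

theorem det_theta_two_two_two {L : Fin 3 → ℕ} (hL : ∀ i, L i = 2) :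
    (distanceMatrix (thetaGraphOf L)).det = -16 := by
  obtain rfl : L = fun _ => 2 := funext hL
  have hs : ∀ i : Fin 5, (![0, 2, 1, 1, 1] : Fin 5 → ℕ) i ≤ 2 := by decide
  let d : Fin 5 → Fin 5 → ℕ :=
    ![![0, 2, 1, 1, 1], ![2, 0, 1, 1, 1], ![1, 1, 0, 2, 2], ![1, 1, 2, 0, 2], ![1, 1, 2, 2, 0]]
  rw [det_distanceMatrix_of_dist (thetaGraphOf fun _ => 2) (fun i : Fin 5 => thetaPoint (fun _ => 2)
    ((![0, 0, 0, 1, 2] : Fin 5 → Fin 3) i) ((![0, 2, 1, 1, 1] : Fin 5 → ℕ) i)) d ?_ ?_ ?_]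
  · have h : (Matrix.of fun i j : Fin 5 => (d i j : ℚ)) =
        !![0, 2, 1, 1, 1; 2, 0, 1, 1, 1; 1, 1, 0, 2, 2; 1, 1, 2, 0, 2; 1, 1, 2, 2, 0] := by
      ext i j
      fin_cases i <;> fin_cases j <;> simp [d]
    rw [h]
    simp [Matrix.det_succ_row_zero, Fin.sum_univ_succ, Fin.succAbove]
    norm_num
  · rw [card_thetaVertex]
    simp
  · intro i j
    rw [dist_thetaPoint (fun _ => by norm_num) (c := 0) (fun _ => le_rfl) (hs i) (hs j)]
    revert i j
    decide
  · decide

/-! ### Isomorphism invariance, reordering of the paths and the case distinction -/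

theorem SimpleGraph.dist_hom_le {V W : Type*} {G : SimpleGraph V} {H : SimpleGraph W} (f : G →g H)
    {u v : V} (h : G.Reachable u v) : H.dist (f u) (f v) ≤ G.dist u v := by
  obtain ⟨w, hw⟩ := h.exists_walk_length_eq_dist
  rw [← hw, ← SimpleGraph.Walk.length_map f w]
  exact SimpleGraph.dist_le _

theorem SimpleGraph.dist_iso {V W : Type*} {G : SimpleGraph V} {H : SimpleGraph W} (f : G ≃g H)
    (u v : V) : H.dist (f u) (f v) = G.dist u v := by
  by_cases h : G.Reachable u v
  · refine le_antisymm (SimpleGraph.dist_hom_le f.toHom h) ?_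
    simpa using SimpleGraph.dist_hom_le f.symm.toHom (h.map f.toHom)
  · rw [SimpleGraph.dist_eq_zero_of_not_reachable h,
      SimpleGraph.dist_eq_zero_of_not_reachable (mt SimpleGraph.Iso.reachable_iff.1 h)]

theorem distanceMatrix_det_congr {V W : Type*} [Fintype V] [DecidableEq V] [Fintype W]
    [DecidableEq W] {G : SimpleGraph V} {H : SimpleGraph W} (f : G ≃g H) :
    (distanceMatrix G).det = (distanceMatrix H).det := by
  rw [← Matrix.det_submatrix_equiv_self f.toEquiv (distanceMatrix H)]
  congr 1
  ext u v
  simp only [distanceMatrix, Matrix.submatrix_apply, Matrix.of_apply]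
  exact congrArg _ (SimpleGraph.dist_iso f u v).symm

theorem multiset_triple_eq {L : Fin 3 → ℕ} {i j k : Fin 3} (hij : i ≠ j) (hik : i ≠ k)
    (hjk : j ≠ k) : ({L 0, L 1, L 2} : Multiset ℕ) = {L i, L j, L k} := by
  have h : ({0, 1, 2} : Multiset (Fin 3)) = {i, j, k} := by
    revert i j k
    decide
  simpa using congrArg (Multiset.map L) h

theorem exists_of_multiset_triple_eq {L : Fin 3 → ℕ} {x y z : ℕ}
    (h : ({L 0, L 1, L 2} : Multiset ℕ) = {x, y, z}) :
    ∃ i j k : Fin 3, i ≠ j ∧ i ≠ k ∧ j ≠ k ∧ L i = x ∧ L j = y ∧ L k = z := by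
  have hx : ∃ i, L i = x := by
    have : x ∈ ({L 0, L 1, L 2} : Multiset ℕ) := by rw [h]; simp
    simp only [Multiset.insert_eq_cons, Multiset.mem_cons, Multiset.mem_singleton] at this
    rcases this with h | h | h
    exacts [⟨0, h.symm⟩, ⟨1, h.symm⟩, ⟨2, h.symm⟩]
  obtain ⟨i, rfl⟩ := hx
  obtain ⟨j, k, hij, hik, hjk⟩ : ∃ j k : Fin 3, i ≠ j ∧ i ≠ k ∧ j ≠ k := by
    clear h
    revert i
    decide
  rw [multiset_triple_eq hij hik hjk] at h
  simp only [Multiset.insert_eq_cons, Multiset.cons_inj_right] at h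
  have hy : y ∈ (L j ::ₘ {L k} : Multiset ℕ) := by rw [h]; simp
  simp only [Multiset.mem_cons, Multiset.mem_singleton] at hy
  rcases hy with rfl | rfl
  · simp only [Multiset.cons_inj_right, Multiset.singleton_inj] at h
    exact ⟨i, j, k, hij, hik, hjk, rfl, rfl, h⟩
  · rw [← Multiset.singleton_add, ← Multiset.singleton_add, add_comm] at h
    simp only [Multiset.singleton_add, Multiset.cons_inj_right, Multiset.singleton_inj] at h
    exact ⟨i, k, j, hik, hij, hjk.symm, rfl, rfl, h⟩

theorem exists_sorted_triple (L : Fin 3 → ℕ) :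
    ∃ i j k : Fin 3, i ≠ j ∧ i ≠ k ∧ j ≠ k ∧ L i ≤ L j ∧ L j ≤ L k := by
  rcases le_total (L 0) (L 1) with h1 | h1 <;> rcases le_total (L 1) (L 2) with h2 | h2 <;>
    rcases le_total (L 0) (L 2) with h3 | h3
  · exact ⟨0, 1, 2, by decide, by decide, by decide, h1, h2⟩
  · exact ⟨0, 1, 2, by decide, by decide, by decide, h1, h2⟩
  · exact ⟨0, 2, 1, by decide, by decide, by decide, h3, h2⟩
  · exact ⟨2, 0, 1, by decide, by decide, by decide, h3, h1⟩
  · exact ⟨1, 0, 2, by decide, by decide, by decide, h1, h3⟩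
  · exact ⟨1, 2, 0, by decide, by decide, by decide, h2, h3⟩
  · exact ⟨2, 1, 0, by decide, by decide, by decide, h2, h1⟩
  · exact ⟨2, 1, 0, by decide, by decide, by decide, h2, h1⟩

theorem det_theta_eq_zero {L : Fin 3 → ℕ} (hL : ∀ i, 1 ≤ L i)
    (hone : ∀ i j, i ≠ j → ¬ (L i = 1 ∧ L j = 1))
    (ha : ¬∃ a b : ℕ, Even a ∧ Even b ∧ ({L 0, L 1, L 2} : Multiset ℕ) = {1, a, b})
    (hb : ({L 0, L 1, L 2} : Multiset ℕ) ≠ {2, 2, 2})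
    (hc : ¬∃ r : ℕ, Odd r ∧ 1 < r ∧ ({L 0, L 1, L 2} : Multiset ℕ) = {2, 2, r}) :
    (distanceMatrix (thetaGraphOf L)).det = 0 := by
  obtain ⟨i, j, k, hij, hik, hjk, h1, h2⟩ := exists_sorted_triple L
  have hmin : ∀ x, L i ≤ L x := by
    intro x
    rcases eq_of_fin_three hij hik hjk x with rfl | rfl | rfl <;> omega
  rw [multiset_triple_eq hij hik hjk] at ha hb hc
  have hi := hL i
  have hone' := hone i j hij
  by_cases h3 : Even (L i + L j)
  · rcases lt_or_eq_of_le h1 with h4 | h4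
    · exact det_eq_zero_of_lt_of_even_add hL hmin h4 h3
    · by_cases h5 : 3 ≤ L i
      · exact det_eq_zero_of_eq hL hmin hij h4 h5
      · have h6 : L i = 2 := by omega
        have h7 : L j = 2 := by omega
        rw [h6, h7] at hb hc
        rcases Nat.even_or_odd (L k) with h8 | h8
        · have h9 : L k ≠ 2 := fun h9 => hb (by rw [h9])
          -- For lengths 2, 2 and an even number at least 4, the even cycle is formed with the
          -- longest path.
          refine det_eq_zero_of_lt_of_even_add hL hmin (j := k) (by omega) ?_
          rw [h6]
          exact even_two.add h8
        · exact absurd ⟨L k, h8, by omega, rfl⟩ hc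
  · have h4 : L i ≠ L j := fun h4 => h3 (h4 ▸ Even.add_self _)
    by_cases h5 : Even (L i + L k)
    · exact det_eq_zero_of_lt_of_even_add hL hmin (by omega) h5
    · rw [Nat.not_even_iff_odd] at h3 h5
      by_cases h6 : 2 ≤ L i
      · exact det_eq_zero_of_odd_add hL hmin hjk h3 h5 h6
      · have h7 : L i = 1 := by omega
        rw [h7] at ha h3 h5
        refine absurd ⟨L j, L k, ?_, ?_, rfl⟩ ha
        · obtain ⟨n, hn⟩ := h3
          exact ⟨n, by omega⟩
        · obtain ⟨n, hn⟩ := h5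
          exact ⟨n, by omega⟩

theorem mainTheorem1 {V : Type*} [Fintype V] [DecidableEq V] (G : SimpleGraph V) (l p q : ℕ)
    (hl : 1 ≤ l) (hp : 1 ≤ p) (hq : 1 ≤ q)
    -- at most one of `l`, `p`, `q` equals `1`
    (hlp : ¬(l = 1 ∧ p = 1)) (hlq : ¬(l = 1 ∧ q = 1)) (hpq : ¬(p = 1 ∧ q = 1))
    (hG : Nonempty (G ≃g thetaGraph l p q)) :
    (∀ a b : ℕ, Even a → Even b → ({l, p, q} : Multiset ℕ) = {1, a, b} →
      (distanceMatrix G).det = -(((a : ℚ) + (b : ℚ)) ^ 2 / 4)) ∧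
    (({l, p, q} : Multiset ℕ) = {2, 2, 2} → (distanceMatrix G).det = -16) ∧
    (∀ r : ℕ, Odd r → 1 < r → ({l, p, q} : Multiset ℕ) = {2, 2, r} →
      (distanceMatrix G).det = (r : ℚ) ^ 2 - 5) ∧
    ((¬∃ a b : ℕ, Even a ∧ Even b ∧ ({l, p, q} : Multiset ℕ) = {1, a, b}) →
      ({l, p, q} : Multiset ℕ) ≠ {2, 2, 2} →
      (¬∃ r : ℕ, Odd r ∧ 1 < r ∧ ({l, p, q} : Multiset ℕ) = {2, 2, r}) →
      (distanceMatrix G).det = 0) := by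
  obtain ⟨f⟩ := hG
  have hdet : (distanceMatrix G).det = (distanceMatrix (thetaGraphOf ![l, p, q])).det :=
    distanceMatrix_det_congr f
  have hL : ∀ i, 1 ≤ (![l, p, q] : Fin 3 → ℕ) i := by
    intro i
    fin_cases i <;> assumption
  rw [hdet]
  refine ⟨fun a b hea heb h => ?_, fun h => ?_, fun r hr hr1 h => ?_, fun ha hb hc => ?_⟩
  · obtain ⟨i, j, k, hij, hik, hjk, hi, hj, hk⟩ :=
      exists_of_multiset_triple_eq (L := ![l, p, q]) h
    obtain ⟨m, rfl⟩ := hea.two_dvd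
    obtain ⟨n, rfl⟩ := heb.two_dvd
    have h1 := hL j
    have h2 := hL k
    rw [det_theta_one_even_even hij hik hjk (by omega) (by omega) hi hj hk]
    push_cast
    ring
  · obtain ⟨i, j, k, hij, hik, hjk, hi, hj, hk⟩ :=
      exists_of_multiset_triple_eq (L := ![l, p, q]) h
    refine det_theta_two_two_two fun x => ?_
    rcases eq_of_fin_three hij hik hjk x with rfl | rfl | rfl <;> assumption
  · obtain ⟨i, j, k, hij, hik, hjk, hi, hj, hk⟩ :=
      exists_of_multiset_triple_eq (L := ![l, p, q]) h
    obtain ⟨n, rfl⟩ := hr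
    rw [det_theta_two_two_odd hij hik hjk (k := n + 1) (by omega) hi hj (by omega)]
    push_cast
    ring
  · refine det_theta_eq_zero hL ?_ ha hb hc
    intro i j hij h
    fin_cases i <;> fin_cases j <;> simp_all
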